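/- Let $(G,+)$ be an Abelian, Hausdorff, locally compact, second-countable topological group with its Borel $\sigma$-algebra, and fix a Haar measure $\mathrm{d}t$ on $G$. Let $M(G)$ be the set of all Borel measures $\xi$ on $G$ with $\xi(K)<\infty$ for every compact $K$, with the $\sigma$-algebra generated by the maps $\xi\mapsto \xi(K)$, $K\subset G$ compact. For $t\in G$ let $\tau_t\xi=\xi(\,\cdot+t)$. A measure $P$ on $M(G)$ is stationary if $(\tau_t)_*P=P$ for all $t\in G$. The Palm measure of a $\sigma$-finite stationary measure $P$ on $M(G)$ is the measure $P_0$ on $M(G)$ given by $$P_0(A)=\int_{M(G)}\int_G \omega(t)\,\mathbf 1(\tau_t\xi\in A)\,\xi(\mathrm{d}t)\,P(\mathrm{d}\xi)$$ for every measurable $A\subset M(G)$ and every measurable $\omega:G\to[0,\infty)$ with $\int_G\omega(t)\,\mathrm{d}t=1$ (the right-hand side does not depend on $\omega$). Let $F(G)$ be the set of continuous maps $B:G\to G$ with $B_0=0$ such that $(\mathrm{Id}+B)_*\xi\in M(G)$ for every $\xi\in M(G)$, with the $\sigma$-algebra generated by the evaluations $B\mapsto B_t$, $t\in G$. For $t\in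 G$ let $\theta_tB=(B_{t+s}-B_t)_{s\in G}$. A $\sigma$-finite measure $\nu$ on $F(G)$ is weakly stationary (has stationary increments) if $(\theta_t)_*\nu=\nu$ for all $t\in G$. For a measure $P_0$ on $M(G)$ and a measure $\nu$ on $F(G)$, let $P_0^\nu$ be the push-forward of $P_0\otimes\nu$ under $(\xi,B)\mapsto(\mathrm{Id}+B)_*\xi$. **Theorem (Perturbed Palm measures).** Let $P_0$ be the Palm measure of a $\sigma$-finite stationary measure $P$ on $M(G)$, and let $\nu$ be a $\sigma$-finite weakly stationary measure on $F(G)$. If $P_0^\nu$ is $\sigma$-finite, then there exists a $\sigma$-finite stationary measure $P^\nu$ on $M(G)$, giving no mass to the zero measure on $G$, such that $P_0^\nu$ is the Palm measure of $P^\nu$. -/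

import Mathlib

open MeasureTheory
open scoped NNReal ENNReal

noncomputable section

namespace PalmPerturbation

section Defs

variable (G : Type*) [AddCommGroup G] [TopologicalSpace G] [MeasurableSpace G]

/-- The space `M(G)` of locally finite (that is, finite on compact sets) Borel measures on `G`. -/
def LocFinMeasure : Type _ :=
  {ξ : Measure G // ∀ K : Set G, IsCompact K → ξ K < ∞}

/-- The `σ`-algebra on `M(G)` generated by the maps `ξ ↦ ξ K`, `K` compact. -/
instance : MeasurableSpace (LocFinMeasure G) :=
  ⨆ (K : Set G) (_ : IsCompact K),
    MeasurableSpace.comap (fun ξ : LocFinMeasure G => ξ.1 K) inferInstance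

/-- The zero measure, as an element of `M(G)`. -/
instance : Zero (LocFinMeasure G) :=
  ⟨⟨0, fun _ _ => by simp⟩⟩

/-- The space `F(G)` of continuous maps `B : G → G` with `B 0 = 0` such that the push-forward of
every locally finite measure under `t ↦ t + B t` is locally finite. -/
def PerturbationMap : Type _ :=
  {B : C(G, G) // B 0 = 0 ∧
    ∀ ξ : LocFinMeasure G, ∀ K : Set G, IsCompact K → (ξ.1.map fun t => t + B t) K < ∞}

/-- The cylindrical `σ`-algebra on `F(G)`, generated by the evaluations `B ↦ B t`. -/
instance : MeasurableSpace (PerturbationMap G) :=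
  ⨆ t : G, MeasurableSpace.comap (fun B : PerturbationMap G => B.1 t) inferInstance

variable {G}

section Translate

variable [IsTopologicalAddGroup G] [BorelSpace G]

/-- The translation `τ_t ξ = ξ(· + t)`, that is, the push-forward of `ξ` under `s ↦ s - t`. -/
def translate (t : G) (ξ : LocFinMeasure G) : LocFinMeasure G :=
  ⟨ξ.1.map fun s => s - t, fun K hK => by
    have h : MeasurableEmbedding fun s : G => s - t := by
      simpa [sub_eq_add_neg] using (Homeomorph.addRight (-t)).measurableEmbedding
    rw [h.map_apply]
    refine ξ.2 _ ?_
    have hc := (Homeomorph.addRight (-t)).isCompact_preimage.2 hK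
    simpa [sub_eq_add_neg] using hc⟩

/-- A measure `P` on `M(G)` is stationary if it is invariant under all translations. -/
def IsStationary (P : Measure (LocFinMeasure G)) : Prop :=
  ∀ t : G, P.map (translate t) = P

/-- `P₀` is the Palm measure of `P` (with respect to the Haar measure `haar`):
`P₀(A) = ∫_M ∫_G ω(t) 1(τ_t ξ ∈ A) ξ(dt) P(dξ)` for every event `A`, for every measurable weight
`ω : G → [0, ∞)` of integral one. -/
def IsPalmMeasure (haar : Measure G) (P P₀ : Measure (LocFinMeasure G)) : Prop :=
  ∀ ω : G → ℝ≥0, Measurable ω → ∫⁻ t, (ω t : ℝ≥0∞) ∂haar = 1 →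
    ∀ A : Set (LocFinMeasure G), MeasurableSet A →
      P₀ A = ∫⁻ ξ, ∫⁻ t, (ω t : ℝ≥0∞) * A.indicator 1 (translate t ξ) ∂ξ.1 ∂P

end Translate

section Perturb

/-- `Γ(ξ, B) = (Id + B)_* ξ`. -/
def perturb (p : LocFinMeasure G × PerturbationMap G) : LocFinMeasure G :=
  ⟨p.1.1.map fun t => t + p.2.1 t, p.2.2.2 p.1⟩

/-- The perturbed measure `P₀^ν`: the push-forward of `P₀ ⊗ ν` under `Γ`. -/
def perturbedMeasure (P₀ : Measure (LocFinMeasure G)) (ν : Measure (PerturbationMap G)) :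
    Measure (LocFinMeasure G) :=
  (P₀.prod ν).map perturb

end Perturb

section Increments

variable [IsTopologicalAddGroup G] [BorelSpace G] [SecondCountableTopology G] [T2Space G]

/-- The increment shift `θ_t B = (B_{t+s} - B_t)_s` on `F(G)`. -/
def incrementShift (t : G) (B : PerturbationMap G) : PerturbationMap G :=
  ⟨⟨fun s => B.1 (t + s) - B.1 t, by fun_prop⟩, by simp, fun ξ K hK => by
    have h := B.2.2 (translate (-t) ξ) ((fun s : G => s - (t + B.1 t)) ⁻¹' K) (by
      have hc := (Homeomorph.addRight (-(t + B.1 t))).isCompact_preimage.2 hK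
      simpa [sub_eq_add_neg] using hc)
    have hm1 : Measurable fun s : G => s + B.1 s := Continuous.measurable (by fun_prop)
    have hm2 : Measurable fun s : G => s - -t := Continuous.measurable (by fun_prop)
    have hm3 : Measurable fun s : G => s - (t + B.1 t) := Continuous.measurable (by fun_prop)
    have hm4 : Measurable fun s : G => s + (B.1 (t + s) - B.1 t) :=
      Continuous.measurable (by fun_prop)
    have hK' := hK.measurableSet
    change (Measure.map (fun s : G => s + (B.1 (t + s) - B.1 t)) ξ.1) K < ∞
    change (Measure.map _ (Measure.map (fun s : G => s - -t) ξ.1)) _ < ∞ at h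
    rw [Measure.map_map hm1 hm2, Measure.map_apply (hm1.comp hm2) (hm3 hK')] at h
    rw [Measure.map_apply hm4 hK']
    convert h using 2
    ext s
    simp only [Set.mem_preimage, Function.comp_apply, sub_neg_eq_add, add_comm s t]
    have : s + (B.1 (t + s) - B.1 t) = t + s + B.1 (t + s) - (t + B.1 t) := by abel
    rw [this]⟩

/-- A measure `ν` on `F(G)` is weakly stationary (has stationary increments) if it is invariant
under all increment shifts. -/
def IsWeaklyStationary (ν : Measure (PerturbationMap G)) : Prop :=
  ∀ t : G, ν.map (incrementShift t) = ν

end Increments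

end Defs

end PalmPerturbation

end

/-!
The proof rests on Mecke's characterisation of Palm measures by an equation that mentions only the
candidate measure `Q` itself: a `σ`-finite measure `Q` on `M(G)` with `Q {0} = 0` is the Palm
measure of a `σ`-finite stationary measure if and only if
`∫∫ f(τ_t ξ, -t) ξ(dt) Q(dξ) = ∫∫ f(ξ, t) ξ(dt) Q(dξ)` for all measurable `f ≥ 0`.

*Necessity.* Averaging over translations turns the definition of the Palm measure into the refined
Campbell formula `∫∫ f(τ_t ξ, t) ξ(dt) P(dξ) = ∫∫ f(ξ, t) dt P₀(dξ)`
(`IsPalmMeasure.refinedCampbell`). By this formula both sides of Mecke's equation become the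
`P`-integral of a double integral over two points of `ξ`, and they differ by exchanging the points
(`RefinedCampbell.meckeEquation`).

*Perturbation.* If `B` displaces the points of `ξ`, then the perturbed measure seen from the
displaced position of `s` is the perturbation of `τ_s ξ` by the increments `θ_s B`
(`translate_perturb`). As the law `ν` of `B` is invariant under `θ_s`, Mecke's equation for `P₀`
gives Mecke's equation for `P₀^ν` (`MeckeEquation.perturbedMeasure`).

*Sufficiency.* Fix a weight `w` with `∫ w(ξ, t) ξ(dt) = 1` for `ξ ≠ 0` and put
`P(f) = ∫∫ w(τ_{-t} ξ, t) f(τ_{-t} ξ) dt Q(dξ)`. Mecke's equation yields the refined Campbell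
formula for `P` and `Q` (`MeckeEquation.refinedCampbell_palmInverse`). The formula contains the Palm
property, shows that `P` does not depend on `w` and hence is stationary
(`RefinedCampbell.isStationary`), and makes `P` `σ`-finite (`RefinedCampbell.sigmaFinite`).

All changes in the order of integration use that `ξ` ranges over `M(G)` as an s-finite kernel.
-/

namespace PalmPerturbation

open ProbabilityTheory Set

set_option linter.unusedSectionVars false

variable {G : Type*} [AddCommGroup G] [TopologicalSpace G] [MeasurableSpace G]
variable {α : Type*} [MeasurableSpace α]

/-! ### Measurability in `M(G)` and `F(G)` -/

theorem LocFinMeasure.measurable_apply_isCompact {K : Set G} (hK : IsCompact K) :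
    Measurable fun ξ : LocFinMeasure G => ξ.1 K := by
  rw [measurable_iff_comap_le]
  exact le_iSup₂ (f := fun (K : Set G) (_ : IsCompact K) =>
    MeasurableSpace.comap (fun ξ : LocFinMeasure G => ξ.1 K) inferInstance) K hK

theorem LocFinMeasure.measurable_of_isCompact {g : α → LocFinMeasure G}
    (hg : ∀ K : Set G, IsCompact K → Measurable fun a => (g a).1 K) : Measurable g := by
  rw [measurable_iff_comap_le]
  simp only [instMeasurableSpaceLocFinMeasure, MeasurableSpace.comap_iSup,
    MeasurableSpace.comap_comp]
  exact iSup₂_le fun K hK => (hg K hK).comap_le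

theorem PerturbationMap.measurable_apply (t : G) :
    Measurable fun B : PerturbationMap G => B.1 t := by
  rw [measurable_iff_comap_le]
  exact le_iSup (fun t : G =>
    MeasurableSpace.comap (fun B : PerturbationMap G => B.1 t) inferInstance) t

theorem PerturbationMap.measurable_of_apply {g : α → PerturbationMap G}
    (hg : ∀ t : G, Measurable fun a => (g a).1 t) : Measurable g := by
  rw [measurable_iff_comap_le]
  simp only [instMeasurableSpacePerturbationMap, MeasurableSpace.comap_iSup,
    MeasurableSpace.comap_comp]
  exact iSup_le fun t => (hg t).comap_le

variable [IsTopologicalAddGroup G] [T2Space G] [LocallyCompactSpace G]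
  [SecondCountableTopology G] [BorelSpace G]

theorem isPiSystem_isCompact : IsPiSystem {K : Set G | IsCompact K} :=
  fun _ hK _ hL _ => hK.inter hL

/-- In a `σ`-compact Hausdorff group the compact sets generate the Borel `σ`-algebra. -/
theorem generateFrom_isCompact :
    ‹MeasurableSpace G› = MeasurableSpace.generateFrom {K : Set G | IsCompact K} := by
  apply le_antisymm
  · rw [BorelSpace.measurable_eq (α := G), borel_eq_generateFrom_isClosed]
    refine MeasurableSpace.generateFrom_le fun s hs => ?_
    have : s = ⋃ n, compactCovering G n ∩ s := by
      rw [← iUnion_inter, iUnion_compactCovering, univ_inter]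
    rw [this]
    exact MeasurableSet.iUnion fun n => MeasurableSpace.measurableSet_generateFrom
      ((isCompact_compactCovering G n).inter_right hs)
  · exact MeasurableSpace.generateFrom_le fun K hK => IsCompact.measurableSet hK

instance (ξ : LocFinMeasure G) : IsFiniteMeasureOnCompacts ξ.1 := ⟨fun {K} hK => ξ.2 K hK⟩

/-- The `σ`-algebra of `M(G)`, although generated by the values on compact sets, makes the values
on all Borel sets measurable. -/
theorem LocFinMeasure.measurable_val : Measurable fun ξ : LocFinMeasure G => ξ.1 := by
  refine Measure.measurable_of_measurable_coe _ fun s hs => ?_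
  -- The compact sets only determine finite measures, so one first restricts to `K n`.
  have hres : ∀ n, Measurable fun ξ : LocFinMeasure G => ξ.1.restrict (compactCovering G n) := by
    intro n
    have hn := isCompact_compactCovering G n
    have (ξ : LocFinMeasure G) : IsFiniteMeasure (ξ.1.restrict (compactCovering G n)) :=
      isFiniteMeasure_restrict.2 (ξ.2 _ hn).ne
    refine Measurable.measure_of_isPiSystem generateFrom_isCompact isPiSystem_isCompact
      (fun K hK => ?_) ?_
    · have hK : IsCompact K := hK
      simp only [Measure.restrict_apply hK.measurableSet]
      exact measurable_apply_isCompact (hK.inter hn)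
    · simp only [Measure.restrict_apply_univ]
      exact measurable_apply_isCompact hn
  have key : ∀ ξ : LocFinMeasure G, ξ.1 s = ⨆ n, ξ.1.restrict (compactCovering G n) s := by
    intro ξ
    simp only [Measure.restrict_apply hs]
    rw [← Monotone.measure_iUnion, ← inter_iUnion, iUnion_compactCovering, inter_univ]
    exact fun m n hmn => inter_subset_inter_right _ (compactCovering_subset G hmn)
  simp only [key]
  exact Measurable.iSup fun n => (Measure.measurable_coe hs).comp (hres n)

/-- The tautological kernel from `M(G)` to `G`, sending `ξ` to `ξ`. -/
noncomputable def evalKernel (G : Type*) [AddCommGroup G] [TopologicalSpace G] [MeasurableSpace G]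
    [IsTopologicalAddGroup G] [T2Space G] [LocallyCompactSpace G]
    [SecondCountableTopology G] [BorelSpace G] : Kernel (LocFinMeasure G) G where
  toFun ξ := ξ.1
  measurable' := LocFinMeasure.measurable_val

theorem evalKernel_apply (ξ : LocFinMeasure G) : evalKernel G ξ = ξ.1 := rfl

/-- The tautological kernel is a countable sum of finite kernels: cut `G` into countably many
relatively compact pieces `D n`, and `M(G)` according to the integer part of `ξ (D n)`. -/
instance : IsSFiniteKernel (evalKernel G) := by
  classical
  let D : ℕ → Set G := disjointed (compactCovering G)
  have hD : ∀ n, MeasurableSet (D n) :=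
    MeasurableSet.disjointed fun n => (isCompact_compactCovering G n).measurableSet
  have hfin : ∀ (ξ : LocFinMeasure G) n, ξ.1 (D n) ≠ ∞ := fun ξ n =>
    ((measure_mono (disjointed_subset _ n)).trans_lt (ξ.2 _ (isCompact_compactCovering G n))).ne
  have hmeas : ∀ n, Measurable fun ξ : LocFinMeasure G => ⌊(ξ.1 (D n)).toNNReal⌋₊ := fun n =>
    Nat.measurable_floor.comp
      ((Measure.measurable_coe (hD n)).comp LocFinMeasure.measurable_val).ennreal_toNNReal
  have hS : ∀ p : ℕ × ℕ, MeasurableSet {ξ : LocFinMeasure G | ⌊(ξ.1 (D p.1)).toNNReal⌋₊ = p.2} :=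
    fun p => hmeas p.1 (measurableSet_singleton p.2)
  let κ : ℕ × ℕ → Kernel (LocFinMeasure G) G := fun p =>
    Kernel.piecewise (hS p) ((evalKernel G).restrict (hD p.1)) 0
  have hκ : ∀ p, IsFiniteKernel (κ p) := by
    refine fun p => ⟨⟨p.2 + 1, by finiteness, fun ξ => ?_⟩⟩
    simp only [κ, Kernel.piecewise_apply]
    split_ifs with h
    · rw [Kernel.restrict_apply, Measure.restrict_apply_univ, evalKernel_apply,
        ← ENNReal.coe_toNNReal (hfin ξ p.1)]
      have h1 := (Nat.lt_floor_add_one (ξ.1 (D p.1)).toNNReal).le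
      rw [show ⌊(ξ.1 (D p.1)).toNNReal⌋₊ = p.2 from h] at h1
      exact_mod_cast h1
    · simp
  have hsum : evalKernel G = Kernel.sum κ := by
    ext ξ s hs
    rw [Kernel.sum_apply' _ _ hs, ENNReal.tsum_prod (f := fun n m => κ (n, m) ξ s)]
    have : ∀ n, ∑' m, κ (n, m) ξ s = ξ.1 (s ∩ D n) := by
      intro n
      rw [tsum_eq_single ⌊(ξ.1 (D n)).toNNReal⌋₊]
      · simp [κ, Kernel.piecewise_apply, Kernel.restrict_apply, Measure.restrict_apply hs,
          evalKernel_apply]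
      · intro m hm
        simp [κ, Kernel.piecewise_apply, hm.symm]
    simp only [this]
    rw [← measure_iUnion, ← inter_iUnion, iUnion_disjointed, iUnion_compactCovering, inter_univ,
      evalKernel_apply]
    · exact fun m n hmn => (disjoint_disjointed _ hmn).mono inter_subset_right inter_subset_right
    · exact fun n => hs.inter (hD n)
  rw [hsum]
  exact Kernel.isSFiniteKernel_sum

/-- Integrals against a measurably varying locally finite measure depend measurably on the
parameter. -/
@[fun_prop]
theorem measurable_lintegral_val {g : α → LocFinMeasure G} {f : α → G → ℝ≥0∞}
    (hg : Measurable g) (hf : Measurable fun p : α × G => f p.1 p.2) :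
    Measurable fun a => ∫⁻ t, f a t ∂(g a).1 :=
  hf.lintegral_kernel_prod_right' (κ := (evalKernel G).comap g hg)

@[fun_prop]
theorem measurable_lintegral_snd {μ : Measure G} [SFinite μ] {f : α → G → ℝ≥0∞}
    (hf : Measurable fun p : α × G => f p.1 p.2) :
    Measurable fun a => ∫⁻ t, f a t ∂μ :=
  hf.lintegral_prod_right'

theorem LocFinMeasure.measurable_of_lintegral {g : α → LocFinMeasure G}
    (hg : ∀ s : Set G, MeasurableSet s → Measurable fun a => ∫⁻ t, s.indicator 1 t ∂(g a).1) :
    Measurable g := by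
  refine LocFinMeasure.measurable_of_isCompact fun K hK => ?_
  simpa [lintegral_indicator_one hK.measurableSet] using hg K hK.measurableSet

/-! ### Translations -/

section Translate

theorem lintegral_translate {f : G → ℝ≥0∞} (hf : Measurable f) (t : G) (ξ : LocFinMeasure G) :
    ∫⁻ s, f s ∂(translate t ξ).1 = ∫⁻ s, f (s - t) ∂ξ.1 :=
  lintegral_map hf (by fun_prop)

@[fun_prop]
theorem measurable_translate {f : α → G} {g : α → LocFinMeasure G} (hf : Measurable f)
    (hg : Measurable g) : Measurable fun a => translate (f a) (g a) := by
  refine LocFinMeasure.measurable_of_lintegral fun s hs => ?_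
  have hs' : Measurable (s.indicator (1 : G → ℝ≥0∞)) := measurable_one.indicator hs
  simp only [lintegral_translate hs']
  fun_prop

theorem translate_translate (s t : G) (ξ : LocFinMeasure G) :
    translate s (translate t ξ) = translate (s + t) ξ := by
  apply Subtype.ext
  change (ξ.1.map _).map _ = ξ.1.map _
  rw [Measure.map_map (by fun_prop) (by fun_prop)]
  congr 1
  ext x
  simp only [Function.comp_apply]
  abel

theorem translate_zero (ξ : LocFinMeasure G) : translate 0 ξ = ξ := by
  apply Subtype.ext
  change ξ.1.map _ = ξ.1
  simp

theorem LocFinMeasure.eq_zero_iff {ξ : LocFinMeasure G} : ξ = 0 ↔ ξ.1 = 0 :=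
  Subtype.ext_iff

theorem translate_eq_zero_iff {t : G} {ξ : LocFinMeasure G} : translate t ξ = 0 ↔ ξ = 0 := by
  rw [LocFinMeasure.eq_zero_iff, LocFinMeasure.eq_zero_iff]
  exact Measure.map_eq_zero_iff (by fun_prop)

theorem measurableSet_singleton_zero : MeasurableSet ({0} : Set (LocFinMeasure G)) := by
  have : ({0} : Set (LocFinMeasure G)) = (fun ξ => ξ.1 univ) ⁻¹' {0} := by
    ext ξ
    simp [LocFinMeasure.eq_zero_iff]
  rw [this]
  exact ((Measure.measurable_coe .univ).comp LocFinMeasure.measurable_val)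
    (measurableSet_singleton 0)

end Translate

/-! ### Perturbations and increments -/

section Perturb

open TopologicalSpace in
/-- Evaluation `(B, t) ↦ B t` is jointly measurable, being measurable in `B` and continuous in
`t`. -/
@[fun_prop]
theorem PerturbationMap.measurable_eval {f : α → PerturbationMap G} {g : α → G}
    (hf : Measurable f) (hg : Measurable g) : Measurable fun a => (f a).1 (g a) := by
  let _ := IsTopologicalAddGroup.rightUniformSpace G
  have : MetrizableSpace G := inferInstance
  have h : Measurable (Function.uncurry fun (t : G) (B : PerturbationMap G) => B.1 t) :=
    measurable_uncurry_of_continuous_of_measurable (fun B => B.1.continuous)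
      PerturbationMap.measurable_apply
  exact h.comp (hg.prodMk hf)

theorem lintegral_perturb {f : G → ℝ≥0∞} (hf : Measurable f)
    (p : LocFinMeasure G × PerturbationMap G) :
    ∫⁻ s, f s ∂(perturb p).1 = ∫⁻ s, f (s + p.2.1 s) ∂p.1.1 :=
  lintegral_map hf (Continuous.measurable (by fun_prop))

@[fun_prop]
theorem measurable_perturb :
    Measurable (perturb : LocFinMeasure G × PerturbationMap G → LocFinMeasure G) := by
  refine LocFinMeasure.measurable_of_lintegral fun s hs => ?_
  have hs' : Measurable (s.indicator (1 : G → ℝ≥0∞)) := measurable_one.indicator hs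
  simp only [lintegral_perturb hs']
  fun_prop

@[fun_prop]
theorem measurable_incrementShift {f : α → G} {g : α → PerturbationMap G} (hf : Measurable f)
    (hg : Measurable g) : Measurable fun a => incrementShift (f a) (g a) := by
  refine PerturbationMap.measurable_of_apply fun t => ?_
  change Measurable fun a => (g a).1 (f a + t) - (g a).1 (f a)
  fun_prop

theorem perturb_eq_zero_iff {p : LocFinMeasure G × PerturbationMap G} :
    perturb p = 0 ↔ p.1 = 0 := by
  rw [LocFinMeasure.eq_zero_iff, LocFinMeasure.eq_zero_iff]
  exact Measure.map_eq_zero_iff (Continuous.measurable (by fun_prop)).aemeasurable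

/-- Seen from the displaced position `s + B s` of a point `s`, the perturbed measure is the
perturbation of the measure seen from `s` by the increments of `B` at `s`. -/
theorem translate_perturb (s : G) (ξ : LocFinMeasure G) (B : PerturbationMap G) :
    translate (s + B.1 s) (perturb (ξ, B)) = perturb (translate s ξ, incrementShift s B) := by
  apply Subtype.ext
  change (ξ.1.map fun t => t + B.1 t).map (fun x => x - (s + B.1 s)) =
    (ξ.1.map fun x => x - s).map fun t => t + (B.1 (s + t) - B.1 s)
  have h1 : Measurable fun t : G => t + B.1 t := Continuous.measurable (by fun_prop)
  have h2 : Measurable fun t : G => t + (B.1 (s + t) - B.1 s) :=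
    Continuous.measurable (by fun_prop)
  rw [Measure.map_map (by fun_prop) h1, Measure.map_map h2 (by fun_prop)]
  congr 1
  ext x
  simp only [Function.comp_apply, add_sub_cancel]
  abel

end Perturb

/-! ### The refined Campbell formula and Mecke's equation -/

/-- The refined Campbell formula
`∫∫ f(τ_t ξ, t) ξ(dt) P(dξ) = ∫∫ f(ξ, t) dt Q(dξ)` for all measurable `f ≥ 0`. -/
def RefinedCampbell (haar : Measure G) (P Q : Measure (LocFinMeasure G)) : Prop :=
  ∀ f : LocFinMeasure G × G → ℝ≥0∞, Measurable f →
    ∫⁻ ξ, ∫⁻ t, f (translate t ξ, t) ∂ξ.1 ∂P = ∫⁻ ξ, ∫⁻ t, f (ξ, t) ∂haar ∂Q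

/-- Mecke's equation `∫∫ f(τ_t ξ, -t) ξ(dt) Q(dξ) = ∫∫ f(ξ, t) ξ(dt) Q(dξ)` for all measurable
`f ≥ 0`; together with `Q {0} = 0` it characterises Palm measures. -/
def MeckeEquation (Q : Measure (LocFinMeasure G)) : Prop :=
  ∀ f : LocFinMeasure G × G → ℝ≥0∞, Measurable f →
    ∫⁻ ξ, ∫⁻ t, f (translate t ξ, -t) ∂ξ.1 ∂Q = ∫⁻ ξ, ∫⁻ t, f (ξ, t) ∂ξ.1 ∂Q

/-- There is an everywhere positive probability density on a `σ`-finite measure space. -/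
theorem exists_pos_lintegral_eq_one {α : Type*} [MeasurableSpace α] (μ : Measure α) [SigmaFinite μ]
    (hμ : μ ≠ 0) :
    ∃ ω : α → ℝ≥0, Measurable ω ∧ (∀ x, 0 < ω x) ∧ ∫⁻ x, ω x ∂μ = 1 := by
  obtain ⟨g, hg0, hgm, hg⟩ := exists_pos_lintegral_lt_of_sigmaFinite μ one_ne_zero
  have hne : ∫⁻ x, g x ∂μ ≠ 0 := by
    rw [← pos_iff_ne_zero, lintegral_pos_iff_support (by fun_prop)]
    have : Function.support (fun x => (g x : ℝ≥0∞)) = univ := by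
      ext x
      simpa using (hg0 x).ne'
    rw [this]
    exact pos_iff_ne_zero.2 (Measure.measure_univ_ne_zero.2 hμ)
  have htop : ∫⁻ x, g x ∂μ ≠ ∞ := (hg.trans ENNReal.one_lt_top).ne
  lift ∫⁻ x, (g x : ℝ≥0∞) ∂μ to ℝ≥0 using htop with c hc
  have hc0 : c ≠ 0 := by simpa using hne
  refine ⟨fun x => c⁻¹ * g x, by fun_prop,
    fun x => mul_pos (inv_pos.2 (pos_iff_ne_zero.2 hc0)) (hg0 x), ?_⟩
  simp only [ENNReal.coe_mul]
  rw [lintegral_const_mul _ (by fun_prop), ← hc, ← ENNReal.coe_mul, inv_mul_cancel₀ hc0,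
    ENNReal.coe_one]

variable {haar : Measure G} [haar.IsAddHaarMeasure] {P P₀ Q : Measure (LocFinMeasure G)}

variable (haar) in
theorem exists_haar_density :
    ∃ ω : G → ℝ≥0, Measurable ω ∧ (∀ x, 0 < ω x) ∧ ∫⁻ x, ω x ∂haar = 1 :=
  exists_pos_lintegral_eq_one haar (NeZero.ne haar)

/-- The Palm measure is the push-forward under `(ξ, t) ↦ τ_t ξ` of the Campbell measure with
density `ω`. -/
theorem IsPalmMeasure.eq_map [SFinite P] (h : IsPalmMeasure haar P P₀) {ω : G → ℝ≥0}
    (hω : Measurable ω) (hω1 : ∫⁻ t, ω t ∂haar = 1) :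
    P₀ = ((P ⊗ₘ evalKernel G).withDensity fun p => ω p.2).map fun p => translate p.2 p.1 := by
  ext A hA
  have hA' : Measurable (A.indicator (1 : LocFinMeasure G → ℝ≥0∞)) := measurable_one.indicator hA
  rw [h ω hω hω1 A hA, ← lintegral_indicator_one hA, lintegral_map hA' (by fun_prop),
    lintegral_withDensity_eq_lintegral_mul _ (by fun_prop) (by fun_prop),
    Measure.lintegral_compProd (by fun_prop)]
  rfl

theorem IsPalmMeasure.sFinite [SFinite P] (h : IsPalmMeasure haar P P₀) : SFinite P₀ := by
  obtain ⟨ω, hω, -, hω1⟩ := exists_haar_density haar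
  rw [h.eq_map hω hω1]
  infer_instance

theorem IsPalmMeasure.lintegral_eq [SFinite P] (h : IsPalmMeasure haar P P₀) {ω : G → ℝ≥0}
    (hω : Measurable ω) (hω1 : ∫⁻ t, ω t ∂haar = 1) {f : LocFinMeasure G → ℝ≥0∞}
    (hf : Measurable f) :
    ∫⁻ ξ, f ξ ∂P₀ = ∫⁻ ξ, ∫⁻ t, ω t * f (translate t ξ) ∂ξ.1 ∂P := by
  rw [h.eq_map hω hω1, lintegral_map hf (by fun_prop),
    lintegral_withDensity_eq_lintegral_mul _ (by fun_prop) (by fun_prop),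
    Measure.lintegral_compProd (by fun_prop)]
  rfl

theorem IsPalmMeasure.measure_zero (h : IsPalmMeasure haar P P₀) : P₀ {0} = 0 := by
  obtain ⟨ω, hω, -, hω1⟩ := exists_haar_density haar
  rw [h ω hω hω1 _ measurableSet_singleton_zero]
  refine (lintegral_congr fun ξ => ?_).trans lintegral_zero
  by_cases hξ : ξ = 0
  · simp [LocFinMeasure.eq_zero_iff.1 hξ]
  · simp [translate_eq_zero_iff, hξ]

theorem IsStationary.lintegral_translate (h : IsStationary P) (s : G)
    {f : LocFinMeasure G → ℝ≥0∞} (hf : Measurable f) :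
    ∫⁻ ξ, f (translate s ξ) ∂P = ∫⁻ ξ, f ξ ∂P := by
  conv_rhs => rw [← h s]
  rw [lintegral_map hf (by fun_prop)]

/-- Averaging the left-hand side over all translations of `P`, with weight `ω`, reduces the refined
Campbell formula to the definition of the Palm measure, applied to the weights `ω(· - u)`. No
`σ`-finiteness of the Palm measure is needed. -/
theorem IsPalmMeasure.refinedCampbell [SFinite P] (h : IsPalmMeasure haar P P₀)
    (hP : IsStationary P) : RefinedCampbell haar P P₀ := by
  intro f hf
  have := h.sFinite
  obtain ⟨ω, hω, -, hω1⟩ := exists_haar_density haar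
  have hshift : ∀ s, ∫⁻ ξ, ∫⁻ t, f (translate t ξ, t) ∂ξ.1 ∂P
      = ∫⁻ ξ, ∫⁻ t, f (translate t ξ, t - s) ∂ξ.1 ∂P := by
    intro s
    rw [← hP.lintegral_translate s (by fun_prop)]
    refine lintegral_congr fun ξ => ?_
    rw [PalmPerturbation.lintegral_translate (by fun_prop)]
    simp [translate_translate]
  calc ∫⁻ ξ, ∫⁻ t, f (translate t ξ, t) ∂ξ.1 ∂P
      = ∫⁻ s, ω s * ∫⁻ ξ, ∫⁻ t, f (translate t ξ, t - s) ∂ξ.1 ∂P ∂haar := by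
        simp_rw [← hshift]
        rw [lintegral_mul_const _ (by fun_prop), hω1, one_mul]
    _ = ∫⁻ s, ∫⁻ ξ, ∫⁻ t, ω s * f (translate t ξ, t - s) ∂ξ.1 ∂P ∂haar := by
        refine lintegral_congr fun s => ?_
        rw [← lintegral_const_mul _ (by fun_prop)]
        refine lintegral_congr fun ξ => ?_
        rw [← lintegral_const_mul _ (by fun_prop)]
    _ = ∫⁻ ξ, ∫⁻ t, ∫⁻ s, ω s * f (translate t ξ, t - s) ∂haar ∂ξ.1 ∂P := by
        rw [lintegral_lintegral_swap (Measurable.aemeasurable (by fun_prop))]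
        refine lintegral_congr fun ξ => ?_
        rw [lintegral_lintegral_swap (Measurable.aemeasurable (by fun_prop))]
    _ = ∫⁻ ξ, ∫⁻ t, ∫⁻ u, ω (t - u) * f (translate t ξ, u) ∂haar ∂ξ.1 ∂P := by
        refine lintegral_congr fun ξ => lintegral_congr fun t => ?_
        rw [← lintegral_sub_left_eq_self _ t]
        simp
    _ = ∫⁻ u, ∫⁻ ξ, ∫⁻ t, ω (t - u) * f (translate t ξ, u) ∂ξ.1 ∂P ∂haar := by
        rw [lintegral_lintegral_swap (Measurable.aemeasurable (by fun_prop))]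
        refine lintegral_congr fun ξ => ?_
        rw [lintegral_lintegral_swap (Measurable.aemeasurable (by fun_prop))]
    _ = ∫⁻ u, ∫⁻ ξ, f (ξ, u) ∂P₀ ∂haar := by
        refine lintegral_congr fun u => ?_
        rw [h.lintegral_eq (ω := fun t => ω (t - u)) (by fun_prop)
          (by rw [← hω1]; exact lintegral_sub_right_eq_self (fun t => (ω t : ℝ≥0∞)) u)
          (by fun_prop)]
    _ = ∫⁻ ξ, ∫⁻ t, f (ξ, t) ∂haar ∂P₀ :=
        lintegral_lintegral_swap (Measurable.aemeasurable (by fun_prop))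

/-- Both sides of Mecke's equation equal
`∫∫∫ ω(t) f(τ_s ξ, t - s) ξ(dt) ξ(ds) P(dξ)`, up to exchanging the two points `s` and `t`. -/
theorem RefinedCampbell.meckeEquation (h : RefinedCampbell haar P Q) : MeckeEquation Q := by
  intro f hf
  obtain ⟨ω, hω, -, hω1⟩ := exists_haar_density haar
  have h1 := h (fun p => ω p.2 * ∫⁻ t, f (translate t p.1, -t) ∂p.1.1) (by fun_prop)
  have h2 := h (fun p => ∫⁻ t, ω (p.2 + t) * f (p.1, t) ∂p.1.1) (by fun_prop)
  have e1 : ∫⁻ ξ, ∫⁻ s, ω s * (∫⁻ t, f (translate t ξ, -t) ∂ξ.1) ∂haar ∂Q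
      = ∫⁻ ξ, ∫⁻ t, f (translate t ξ, -t) ∂ξ.1 ∂Q := by
    refine lintegral_congr fun ξ => ?_
    rw [lintegral_mul_const _ (by fun_prop), hω1, one_mul]
  have e2 : ∫⁻ ξ, ∫⁻ s, ∫⁻ t, ω (s + t) * f (ξ, t) ∂ξ.1 ∂haar ∂Q
      = ∫⁻ ξ, ∫⁻ t, f (ξ, t) ∂ξ.1 ∂Q := by
    refine lintegral_congr fun ξ => ?_
    rw [lintegral_lintegral_swap (Measurable.aemeasurable (by fun_prop))]
    refine lintegral_congr fun t => ?_
    rw [lintegral_mul_const _ (by fun_prop),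
      lintegral_add_right_eq_self (fun s => (ω s : ℝ≥0∞)) t, hω1, one_mul]
  rw [← e1, ← h1, ← e2, ← h2]
  refine lintegral_congr fun ξ => ?_
  have e3 : ∀ s, ω s * ∫⁻ t, f (translate t (translate s ξ), -t) ∂(translate s ξ).1
      = ∫⁻ t, ω s * f (translate t ξ, s - t) ∂ξ.1 := by
    intro s
    rw [PalmPerturbation.lintegral_translate (by fun_prop), ← lintegral_const_mul _ (by fun_prop)]
    simp [translate_translate]
  have e4 : ∀ s, ∫⁻ t, ω (s + t) * f (translate s ξ, t) ∂(translate s ξ).1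
      = ∫⁻ t, ω t * f (translate s ξ, t - s) ∂ξ.1 := by
    intro s
    rw [PalmPerturbation.lintegral_translate (by fun_prop)]
    simp
  simp only [e3, e4]
  exact lintegral_lintegral_swap (Measurable.aemeasurable (by fun_prop))

/-! ### Perturbation preserves Mecke's equation -/

theorem perturbedMeasure_zero {ν : Measure (PerturbationMap G)} [SFinite ν] (h0 : Q {0} = 0) :
    perturbedMeasure Q ν {0} = 0 := by
  rw [perturbedMeasure, Measure.map_apply measurable_perturb measurableSet_singleton_zero]
  have : perturb ⁻¹' ({0} : Set (LocFinMeasure G))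
      = ({0} : Set (LocFinMeasure G)) ×ˢ (univ : Set (PerturbationMap G)) := by
    ext p
    simp [perturb_eq_zero_iff]
  rw [this, Measure.prod_prod, h0, zero_mul]

theorem lintegral_perturbedMeasure {ν : Measure (PerturbationMap G)} [SFinite Q] [SFinite ν]
    {f : LocFinMeasure G × G → ℝ≥0∞} (hf : Measurable f) :
    ∫⁻ η, ∫⁻ t, f (η, t) ∂η.1 ∂(perturbedMeasure Q ν)
      = ∫⁻ ξ, ∫⁻ s, ∫⁻ B, f (perturb (ξ, B), s + B.1 s) ∂ν ∂ξ.1 ∂Q := by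
  rw [perturbedMeasure, lintegral_map (by fun_prop) measurable_perturb,
    lintegral_prod _ (Measurable.aemeasurable (by fun_prop))]
  refine lintegral_congr fun ξ => ?_
  rw [← lintegral_lintegral_swap (Measurable.aemeasurable (by fun_prop))]
  refine lintegral_congr fun B => ?_
  rw [lintegral_perturb (by fun_prop)]

/-- Moving the origin from `0` to a point `s` of `ξ` turns `(Γ(ξ, B), s + B s)` into
`(Γ(τ_s ξ, θ_s B), -s + (θ_s B)(-s))`; integrating out `B`, whose law is invariant under `θ_s`,
leaves Mecke's equation for `Q`. -/
theorem MeckeEquation.perturbedMeasure {ν : Measure (PerturbationMap G)} [SFinite Q] [SFinite ν]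
    (h : MeckeEquation Q) (hν : IsWeaklyStationary ν) :
    MeckeEquation (perturbedMeasure Q ν) := by
  intro f hf
  rw [lintegral_perturbedMeasure (f := fun p => f (translate p.2 p.1, -p.2)) (by fun_prop),
    lintegral_perturbedMeasure hf,
    ← h (fun p => ∫⁻ B, f (perturb (p.1, B), p.2 + B.1 p.2) ∂ν) (by fun_prop)]
  refine lintegral_congr fun ξ => lintegral_congr fun s => ?_
  have hB : ∀ B : PerturbationMap G, -(s + B.1 s) = -s + (incrementShift s B).1 (-s) := by
    intro B
    change _ = -s + (B.1 (s + -s) - B.1 s)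
    rw [add_neg_cancel, B.2.1]
    abel
  simp only [translate_perturb, hB]
  conv_rhs => rw [← hν s]
  rw [lintegral_map (by fun_prop) (by fun_prop)]

/-! ### Inversion: a measure satisfying Mecke's equation is a Palm measure -/

/-- A normalised weight: a measurable `w ≥ 0` on `M(G) × G` with `∫ w(ξ, t) ξ(dt) = 1` for every
nonzero `ξ`. -/
structure IsWeight (w : LocFinMeasure G × G → ℝ≥0∞) : Prop where
  measurable : Measurable w
  lintegral_eq_one : ∀ ξ : LocFinMeasure G, ξ ≠ 0 → ∫⁻ t, w (ξ, t) ∂ξ.1 = 1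

theorem exists_isWeight : ∃ w : LocFinMeasure G × G → ℝ≥0∞, IsWeight w := by
  let K : ℕ → Set G := compactCovering G
  have hK : ∀ n, IsCompact (K n) := isCompact_compactCovering G
  -- `φ` is positive on `G`, and each `K n` contributes at most `2⁻¹ ^ n` to its integral.
  let φ : LocFinMeasure G × G → ℝ≥0∞ := fun p =>
    ∑' n, (2⁻¹ : ℝ≥0∞) ^ n * (1 + p.1.1 (K n))⁻¹ * (K n).indicator 1 p.2
  have hKm : ∀ n, Measurable fun p : LocFinMeasure G × G => p.1.1 (K n) := fun n =>
    (LocFinMeasure.measurable_apply_isCompact (hK n)).comp measurable_fst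
  have hind : ∀ n, Measurable ((K n).indicator (1 : G → ℝ≥0∞)) := fun n =>
    measurable_one.indicator (hK n).measurableSet
  have hφ : Measurable φ := Measurable.tsum fun n => by
    have := hKm n
    have := hind n
    fun_prop
  have hint : ∀ ξ : LocFinMeasure G, ∫⁻ t, φ (ξ, t) ∂ξ.1
      = ∑' n, (2⁻¹ : ℝ≥0∞) ^ n * (1 + ξ.1 (K n))⁻¹ * ξ.1 (K n) := by
    intro ξ
    simp only [φ]
    rw [lintegral_tsum fun n => ((hind n).const_mul _).aemeasurable]
    refine tsum_congr fun n => ?_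
    rw [lintegral_const_mul _ (hind n), lintegral_indicator_one (hK n).measurableSet]
  refine ⟨fun p => (∫⁻ t, φ (p.1, t) ∂p.1.1)⁻¹ * φ p, by fun_prop, fun ξ hξ => ?_⟩
  dsimp only
  rw [lintegral_const_mul _ (by fun_prop)]
  apply ENNReal.inv_mul_cancel
  · rw [hint, Ne, ENNReal.tsum_eq_zero]
    intro h0
    apply hξ
    rw [LocFinMeasure.eq_zero_iff, ← Measure.measure_univ_eq_zero, ← iUnion_compactCovering G,
      measure_iUnion_null_iff]
    intro n
    have hn : 1 + ξ.1 (K n) ≠ ∞ := ENNReal.add_ne_top.2 ⟨by simp, (ξ.2 _ (hK n)).ne⟩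
    have := h0 n
    simp only [mul_eq_zero, pow_eq_zero_iff', ENNReal.inv_eq_zero, hn, or_false] at this
    simpa using this
  · rw [hint]
    refine ne_top_of_le_ne_top (b := ∑' n, (2⁻¹ : ℝ≥0∞) ^ n) ?_ (ENNReal.tsum_le_tsum fun n => ?_)
    · simp [ENNReal.tsum_geometric]
    · rw [mul_assoc]
      refine mul_le_of_le_one_right' ?_
      rw [mul_comm, ← div_eq_mul_inv]
      exact ENNReal.div_le_of_le_mul (by rw [one_mul]; exact le_add_self)

theorem IsWeight.translate {w : LocFinMeasure G × G → ℝ≥0∞} (hw : IsWeight w) (u : G) :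
    IsWeight fun p => w (translate u p.1, p.2 - u) := by
  have hwm := hw.measurable
  refine ⟨by fun_prop, fun ξ hξ => ?_⟩
  rw [← hw.lintegral_eq_one (PalmPerturbation.translate u ξ) (mt translate_eq_zero_iff.1 hξ),
    lintegral_translate (by fun_prop)]

/-- The measure `f ↦ ∫∫ w(τ_{-t} ξ, t) f(τ_{-t} ξ) dt Q(dξ)` on `M(G)`, which recovers a stationary
measure from its Palm measure `Q`. -/
noncomputable def palmInverse (haar : Measure G) (w : LocFinMeasure G × G → ℝ≥0∞)
    (Q : Measure (LocFinMeasure G)) : Measure (LocFinMeasure G) :=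
  ((Q.prod haar).withDensity fun p => w (translate (-p.2) p.1, p.2)).map
    fun p => translate (-p.2) p.1

theorem lintegral_palmInverse [SFinite Q] {w : LocFinMeasure G × G → ℝ≥0∞} (hw : Measurable w)
    {f : LocFinMeasure G → ℝ≥0∞} (hf : Measurable f) :
    ∫⁻ ξ, f ξ ∂(palmInverse haar w Q)
      = ∫⁻ ξ, ∫⁻ t, w (translate (-t) ξ, t) * f (translate (-t) ξ) ∂haar ∂Q := by
  rw [palmInverse, lintegral_map hf (by fun_prop),
    lintegral_withDensity_eq_lintegral_mul _ (by fun_prop) (by fun_prop),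
    lintegral_prod _ (Measurable.aemeasurable (by fun_prop))]
  rfl

theorem palmInverse_zero [SFinite Q] {w : LocFinMeasure G × G → ℝ≥0∞} (hw : Measurable w)
    (h0 : Q {0} = 0) : palmInverse haar w Q {0} = 0 := by
  rw [← lintegral_indicator_one measurableSet_singleton_zero,
    lintegral_palmInverse hw (measurable_one.indicator measurableSet_singleton_zero)]
  have hae : ∀ᵐ ξ ∂Q, ξ ≠ 0 := measure_eq_zero_iff_ae_notMem.1 h0
  refine (lintegral_congr_ae ?_).trans lintegral_zero
  filter_upwards [hae] with ξ hξ
  simp [translate_eq_zero_iff, hξ]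

/-- After inserting the definition of `palmInverse`, Mecke's equation moves the origin to the point
`t` of `ξ`; the inner integral over `t` is then that of a translated weight, hence `1`. -/
theorem MeckeEquation.refinedCampbell_palmInverse [SFinite Q] (h : MeckeEquation Q)
    (h0 : Q {0} = 0) {w : LocFinMeasure G × G → ℝ≥0∞} (hw : IsWeight w) :
    RefinedCampbell haar (palmInverse haar w Q) Q := by
  intro f hf
  have hwm := hw.measurable
  have hae : ∀ᵐ ξ ∂Q, ξ ≠ 0 := measure_eq_zero_iff_ae_notMem.1 h0
  calc ∫⁻ ξ, ∫⁻ t, f (translate t ξ, t) ∂ξ.1 ∂(palmInverse haar w Q)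
      = ∫⁻ ξ, ∫⁻ s, ∫⁻ t, w (translate (-s) ξ, s) * f (translate t ξ, t + s) ∂ξ.1 ∂haar ∂Q := by
        rw [lintegral_palmInverse hwm (by fun_prop)]
        refine lintegral_congr fun ξ => lintegral_congr fun s => ?_
        rw [lintegral_translate (by fun_prop), ← lintegral_const_mul _ (by fun_prop)]
        simp [translate_translate]
    _ = ∫⁻ ξ, ∫⁻ t, ∫⁻ s, w (translate (-t - s) (translate t ξ), s)
          * f (translate t ξ, s - -t) ∂haar ∂ξ.1 ∂Q := by
        refine lintegral_congr fun ξ => ?_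
        rw [lintegral_lintegral_swap (Measurable.aemeasurable (by fun_prop))]
        refine lintegral_congr fun t => lintegral_congr fun s => ?_
        rw [translate_translate, sub_neg_eq_add, add_comm t s]
        congr 4
        abel
    _ = ∫⁻ ξ, ∫⁻ t, ∫⁻ s, w (translate (t - s) ξ, s) * f (ξ, s - t) ∂haar ∂ξ.1 ∂Q :=
        h (fun p => ∫⁻ s, w (translate (p.2 - s) p.1, s) * f (p.1, s - p.2) ∂haar) (by fun_prop)
    _ = ∫⁻ ξ, ∫⁻ s, ∫⁻ t, w (translate (-s) ξ, t - -s) * f (ξ, s) ∂ξ.1 ∂haar ∂Q := by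
        refine lintegral_congr fun ξ => ?_
        conv_rhs => rw [lintegral_lintegral_swap (Measurable.aemeasurable (by fun_prop))]
        refine lintegral_congr fun t => ?_
        rw [← lintegral_add_right_eq_self (μ := haar) _ t]
        refine lintegral_congr fun s => ?_
        simp [add_comm]
    _ = ∫⁻ ξ, ∫⁻ s, f (ξ, s) ∂haar ∂Q := by
        refine lintegral_congr_ae ?_
        filter_upwards [hae] with ξ hξ
        refine lintegral_congr fun s => ?_
        rw [lintegral_mul_const _ (by fun_prop), (hw.translate (-s)).lintegral_eq_one ξ hξ, one_mul]

/-- The refined Campbell formula expresses `P` through `Q`, whatever weight is used. -/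
theorem RefinedCampbell.eq_palmInverse [SFinite Q] (h : RefinedCampbell haar P Q)
    (h0 : P {0} = 0) {w : LocFinMeasure G × G → ℝ≥0∞} (hw : IsWeight w) :
    P = palmInverse haar w Q := by
  have hwm := hw.measurable
  have hae : ∀ᵐ ξ ∂P, ξ ≠ 0 := measure_eq_zero_iff_ae_notMem.1 h0
  refine Measure.ext_of_lintegral _ fun f hf => ?_
  rw [lintegral_palmInverse hwm hf,
    ← h (fun p => w (translate (-p.2) p.1, p.2) * f (translate (-p.2) p.1)) (by fun_prop)]
  refine lintegral_congr_ae ?_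
  filter_upwards [hae] with ξ hξ
  simp only [translate_translate, neg_add_cancel, translate_zero]
  rw [lintegral_mul_const _ (by fun_prop), hw.lintegral_eq_one ξ hξ, one_mul]

/-- Translating `palmInverse haar w Q` amounts to translating the weight `w`, hence changes
nothing. -/
theorem RefinedCampbell.isStationary [SFinite Q] (h : RefinedCampbell haar P Q)
    (h0 : P {0} = 0) : IsStationary P := by
  intro u
  obtain ⟨w, hw⟩ := exists_isWeight (G := G)
  have hwm := hw.measurable
  conv_rhs => rw [h.eq_palmInverse h0 (hw.translate (-u))]
  conv_lhs => rw [h.eq_palmInverse h0 hw]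
  have hwu := (hw.translate (-u)).measurable
  refine Measure.ext_of_lintegral _ fun f hf => ?_
  rw [lintegral_map hf (by fun_prop), lintegral_palmInverse hwm (by fun_prop),
    lintegral_palmInverse hwu hf]
  refine lintegral_congr fun ξ => ?_
  rw [← lintegral_add_right_eq_self _ u]
  refine lintegral_congr fun t => ?_
  simp only [translate_translate, neg_add_rev, sub_neg_eq_add, add_neg_cancel_left]

theorem RefinedCampbell.isPalmMeasure (h : RefinedCampbell haar P Q) :
    IsPalmMeasure haar P Q := by
  intro ω hω hω1 A hA
  have hA' : Measurable (A.indicator (1 : LocFinMeasure G → ℝ≥0∞)) := measurable_one.indicator hA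
  rw [h (fun p => ω p.2 * A.indicator 1 p.1) (by fun_prop), ← lintegral_indicator_one hA]
  refine lintegral_congr fun ξ => ?_
  dsimp only
  rw [lintegral_mul_const _ (by fun_prop), hω1, one_mul]

/-- A measure which gives finite integral to an almost everywhere positive function is
`σ`-finite. -/
theorem sigmaFinite_of_lintegral_ne_top {α : Type*} [MeasurableSpace α] {μ : Measure α}
    {f : α → ℝ≥0∞} (hf : Measurable f) (hint : ∫⁻ x, f x ∂μ ≠ ∞) (hpos : ∀ᵐ x ∂μ, f x ≠ 0) :
    SigmaFinite μ := by
  refine ⟨⟨⟨fun n => {x | f x = 0} ∪ {x | (n + 1 : ℝ≥0∞)⁻¹ ≤ f x}, fun _ => trivial,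
    fun n => ?_, ?_⟩⟩⟩
  · refine (measure_union_le _ _).trans_lt (ENNReal.add_lt_top.2 ⟨?_, ?_⟩)
    · have : μ {x | f x = 0} = 0 := by simpa [ae_iff] using hpos
      simp [this]
    · refine (meas_ge_le_lintegral_div hf.aemeasurable (by simp) (by simp)).trans_lt ?_
      exact ENNReal.div_lt_top hint (by simp)
  · refine eq_univ_of_forall fun x => mem_iUnion.2 ?_
    by_cases hx : f x = 0
    · exact ⟨0, Or.inl hx⟩
    · obtain ⟨n, hn⟩ := ENNReal.exists_inv_nat_lt hx
      refine ⟨n, Or.inr (le_trans ?_ hn.le)⟩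
      exact ENNReal.inv_le_inv.2 le_self_add

/-- If `h > 0` is `Q`-integrable and `ω > 0` is a Haar density, then
`ξ ↦ ∫ ω(t) h(τ_t ξ) ξ(dt)` is `P`-integrable, and it is positive at every `ξ ≠ 0`. -/
theorem RefinedCampbell.sigmaFinite [SigmaFinite Q] (h : RefinedCampbell haar P Q)
    (h0 : P {0} = 0) : SigmaFinite P := by
  obtain ⟨ω, hω, hω0, hω1⟩ := exists_haar_density haar
  obtain ⟨g, hg0, hgm, hg⟩ := exists_pos_lintegral_lt_of_sigmaFinite Q one_ne_zero
  have hae : ∀ᵐ ξ ∂P, ξ ≠ 0 := measure_eq_zero_iff_ae_notMem.1 h0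
  refine sigmaFinite_of_lintegral_ne_top
    (f := fun ξ => ∫⁻ t, ω t * g (translate t ξ) ∂ξ.1) (by fun_prop) ?_ ?_
  · rw [h (fun p => ω p.2 * g p.1) (by fun_prop)]
    refine ne_top_of_le_ne_top (hg.trans ENNReal.one_lt_top).ne (lintegral_mono fun ξ => ?_)
    dsimp only
    rw [lintegral_mul_const _ (by fun_prop), hω1, one_mul]
  · filter_upwards [hae] with ξ hξ
    rw [← pos_iff_ne_zero, lintegral_pos_iff_support (by fun_prop)]
    have : Function.support (fun t => (ω t : ℝ≥0∞) * g (translate t ξ)) = univ := by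
      ext t
      simp [(hω0 t).ne', (hg0 (translate t ξ)).ne']
    rw [this]
    exact pos_iff_ne_zero.2 (Measure.measure_univ_ne_zero.2 (mt LocFinMeasure.eq_zero_iff.2 hξ))

/-- Mecke's characterisation: a `σ`-finite measure that satisfies Mecke's equation and does not
charge the zero measure is the Palm measure of a `σ`-finite stationary measure. -/
theorem MeckeEquation.exists_isPalmMeasure (haar : Measure G) [haar.IsAddHaarMeasure]
    [SigmaFinite Q] (h : MeckeEquation Q) (h0 : Q {0} = 0) :
    ∃ P : Measure (LocFinMeasure G),
      SigmaFinite P ∧ IsStationary P ∧ P {0} = 0 ∧ IsPalmMeasure haar P Q := by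
  obtain ⟨w, hw⟩ := exists_isWeight (G := G)
  have hC : RefinedCampbell haar (palmInverse haar w Q) Q := h.refinedCampbell_palmInverse h0 hw
  have hP0 : palmInverse haar w Q {0} = 0 := palmInverse_zero hw.measurable h0
  exact ⟨_, hC.sigmaFinite hP0, hC.isStationary hP0, hP0, hC.isPalmMeasure⟩

end PalmPerturbation

theorem mainTheorem1 {G : Type*} [AddCommGroup G] [TopologicalSpace G] [IsTopologicalAddGroup G]
    [T2Space G] [LocallyCompactSpace G] [SecondCountableTopology G]
    [MeasurableSpace G] [BorelSpace G]
    (haar : Measure G) [haar.IsAddHaarMeasure]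
    (P P₀ : Measure (PalmPerturbation.LocFinMeasure G))
    [SigmaFinite P] (hP : PalmPerturbation.IsStationary P)
    (hP₀ : PalmPerturbation.IsPalmMeasure haar P P₀)
    (ν : Measure (PalmPerturbation.PerturbationMap G))
    [SigmaFinite ν] (hν : PalmPerturbation.IsWeaklyStationary ν)
    (hPν : SigmaFinite (PalmPerturbation.perturbedMeasure P₀ ν)) :
    ∃ Pν : Measure (PalmPerturbation.LocFinMeasure G),
      SigmaFinite Pν ∧ PalmPerturbation.IsStationary Pν ∧ Pν {0} = 0 ∧
        PalmPerturbation.IsPalmMeasure haar Pν (PalmPerturbation.perturbedMeasure P₀ ν) := by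
  have := hP₀.sFinite
  have hM := (hP₀.refinedCampbell hP).meckeEquation.perturbedMeasure hν
  exact hM.exists_isPalmMeasure haar (PalmPerturbation.perturbedMeasure_zero hP₀.measure_zero)
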